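/- **Setting.** Let $n\ge 0$, and let $g_1,\dots,g_{j_*}\in\mathbb R[X_1,\dots,X_d]$ be weights, with $\mathbb K=\{\mathbf x\in\mathbb R^d : g_j(\mathbf x)\ge 0,\ 1\le j\le j_*\}$. Put $n_j=\lfloor (n-\deg g_j)/2\rfloor$. Let $B(\mathbf X)$ be the block diagonal polynomial matrix whose $j$-th block is $\big(g_j(\mathbf X)\,\mathbf X^{\alpha}\mathbf X^{\beta}\big)_{|\alpha|,|\beta|\le n_j}$ (an empty block if $\deg g_j>n$), and let $p_B=\operatorname{tr}B(\mathbf X)$. Let $\mathbf x_1,\dots,\mathbf x_{r_*}\in\mathbb K$, where $r_*$ is the dimension of the space $P^n$ of real polynomials in $d$ variables of total degree at most $n$, be unisolvent: every polynomial in $P^n$ is determined by its values at these points. Put $B_r=B(\mathbf x_r)$. For $\lambda\in\mathbb R^{r_*}$ let $M(\lambda)=I+\sum_r\lambda_rB_r$, and let $\mathcal D=\{\lambda : M(\lambda)\succ 0\}$. The function $G:\mathbb R^{r_*}\to\mathbb R\cup\{+\infty\}$ associated with a polynomial $p$ is $$G(\lambda)=\operatorname{tr}\big(M(\lambda)^{-1}\big)+\sum_{r=1}^{r_*}\lambda_r\,p(\mathbf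 x_r)\ \text{ if }\lambda\in\mathcal D,\qquad G(\lambda)=+\infty\ \text{ otherwise.}$$ $G$ is coercive if $G(\lambda)\to+\infty$ as $\|\lambda\|\to+\infty$; a critical point of $G$ is a $\lambda\in\mathcal D$ with $\nabla G(\lambda)=0$. For $\lambda\in\mathcal D$ let $q_{ij}[\lambda]=\sum_{|\alpha|\le n_j}c^{ij}_\alpha\mathbf X^\alpha$, where $(c^{ij}_\alpha)_{j,\alpha}$ is the $i$-th column of $M(\lambda)^{-1}$, and $p[\lambda]=\sum_j g_j\sum_i q_{ij}[\lambda]^2$. **Theorem.** 1. (Multivariate case.) Assume that the matrices $B_1,\dots,B_{r_*}$ are linearly independent. (a) Let $p=\sum_{j} g_j\sum_{i} q_{ij}^2$ be a finite weighted sum of squares with $\deg q_{ij}\le n_j$ (and $q_{ij}=0$ if $n_j<0$), let $\varepsilon>0$, and let $G^\varepsilon$ be the function associated with $p^\varepsilon=p+\varepsilon p_B$. Then $G^\varepsilon$ is coercive, it is strictly convex on $\mathcal D$, and it has a unique critical point in $\mathcal D$. (b) If $p\in P^n$ is strictly positive on $\mathbb K$, then the function $G$ associated with $p$ is strictly convex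 on $\mathcal D$. 2. (Univariate case.) Let $d=1$, take any $n+1$ distinct points of $[0,1]$, and take the Lukács weights $g_1=1,\ g_2=x(1-x)$ if $n$ is even, $g_1=x,\ g_2=1-x$ if $n$ is odd. Then the matrices $B_r$ are linearly independent. If moreover $p$ is a polynomial of degree at most $n$ with $p>0$ on $[0,1]$, then the function $G$ associated with $p$ is strictly convex on $\mathcal D$ and coercive, it has a unique critical point $\lambda_*$ in $\mathcal D$, and $p[\lambda_*]=p$. -/

import Mathlib

open Filter Topology

noncomputable section

namespace SOSInterp

/-- The basic closed semi-algebraic set `{x ∈ ℝ^d | g_j(x) ≥ 0 for all j}`. -/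
def semialgSet {d J : ℕ} (g : Fin J → MvPolynomial (Fin d) ℝ) : Set (Fin d → ℝ) :=
  {x | ∀ j, 0 ≤ MvPolynomial.eval x (g j)}

/-- The multi-indices `α` with `|α| ≤ n_j`, where `n_j = ⌊(n - deg g_j) / 2⌋` and `w = g_j`.
The inequality is written without division; there is no such `α` if `deg g_j > n`. -/
abbrev BlockIdx {d : ℕ} (n : ℕ) (w : MvPolynomial (Fin d) ℝ) : Type :=
  {α : Fin d →₀ ℕ // w.totalDegree + 2 * α.degree ≤ n}

instance {d : ℕ} (n : ℕ) (w : MvPolynomial (Fin d) ℝ) : Finite (BlockIdx n w) :=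
  Set.Finite.subset (Finsupp.finite_of_degree_le n) (fun α (hα : _ ≤ n) => by
    show _ ≤ n; omega)

instance {d : ℕ} (n : ℕ) (w : MvPolynomial (Fin d) ℝ) : Fintype (BlockIdx n w) :=
  Fintype.ofFinite _

/-- The index set of a Cholesky factor: pairs `(j, α)` with `|α| ≤ n_j`. -/
abbrev Idx {d J : ℕ} (n : ℕ) (g : Fin J → MvPolynomial (Fin d) ℝ) : Type :=
  Σ j : Fin J, BlockIdx n (g j)

/-- The polynomial valued block diagonal matrix `B(X)`, whose `j`-th diagonal block is
`g_j(X) X^α X^β`, `|α|, |β| ≤ n_j`. -/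
def polyB {d J : ℕ} (n : ℕ) (g : Fin J → MvPolynomial (Fin d) ℝ) :
    Matrix (Idx n g) (Idx n g) (MvPolynomial (Fin d) ℝ) :=
  Matrix.blockDiagonal' fun j => Matrix.of fun (α β : BlockIdx n (g j)) =>
    g j * (MvPolynomial.monomial α.1 1 * MvPolynomial.monomial β.1 1)

/-- The value `B(x)` at a point `x ∈ ℝ^d`. -/
def evalB {d J : ℕ} (n : ℕ) (g : Fin J → MvPolynomial (Fin d) ℝ) (x : Fin d → ℝ) :
    Matrix (Idx n g) (Idx n g) ℝ :=
  (polyB n g).map (MvPolynomial.eval x)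

/-- The polynomial `p_B(X) = tr B(X)`. -/
def traceB {d J : ℕ} (n : ℕ) (g : Fin J → MvPolynomial (Fin d) ℝ) : MvPolynomial (Fin d) ℝ :=
  (polyB n g).trace

/-- The points `x_1, …, x_R` are unisolvent for the polynomials of total degree at most `n`:
their number is the dimension of this space, and a polynomial in it is determined by its values
at these points. -/
structure IsUnisolvent {d R : ℕ} (n : ℕ) (x : Fin R → Fin d → ℝ) : Prop where
  card_eq : R = Module.finrank ℝ (MvPolynomial.restrictTotalDegree (Fin d) ℝ n)
  determined : ∀ p ∈ MvPolynomial.restrictTotalDegree (Fin d) ℝ n,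
    ∀ q ∈ MvPolynomial.restrictTotalDegree (Fin d) ℝ n,
      (∀ r, MvPolynomial.eval (x r) p = MvPolynomial.eval (x r) q) → p = q

/-- `p = ∑_j g_j ∑_i q_ij²` for finitely many polynomials `q_ij` of degree at most `n_j`. -/
def IsWeightedSOS {d J : ℕ} (n : ℕ) (g : Fin J → MvPolynomial (Fin d) ℝ)
    (p : MvPolynomial (Fin d) ℝ) : Prop :=
  ∃ (m : ℕ) (q : Fin m → Fin J → MvPolynomial (Fin d) ℝ),
    (∀ i j, ∀ α ∈ (q i j).support, (g j).totalDegree + 2 * α.degree ≤ n) ∧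
    p = ∑ j, g j * ∑ i, q i j ^ 2

/-- `M(λ) = I + ∑_r λ_r B(x_r)`. -/
def matM {d J R : ℕ} (n : ℕ) (g : Fin J → MvPolynomial (Fin d) ℝ) (x : Fin R → Fin d → ℝ)
    (l : EuclideanSpace ℝ (Fin R)) : Matrix (Idx n g) (Idx n g) ℝ :=
  1 + ∑ r, l r • evalB n g (x r)

/-- The domain `𝓓 = {λ | M(λ) ≻ 0}`. -/
def domainD {d J R : ℕ} (n : ℕ) (g : Fin J → MvPolynomial (Fin d) ℝ) (x : Fin R → Fin d → ℝ) :
    Set (EuclideanSpace ℝ (Fin R)) :=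
  {l | (matM n g x l).PosDef}

/-- The formula `tr (M(λ)⁻¹) + ∑_r y_r λ_r` for `G` on `𝓓`, with the data `y_r = p(x_r)`. -/
def finiteG {d J R : ℕ} (n : ℕ) (g : Fin J → MvPolynomial (Fin d) ℝ) (x : Fin R → Fin d → ℝ)
    (p : MvPolynomial (Fin d) ℝ) (l : EuclideanSpace ℝ (Fin R)) : ℝ :=
  ((matM n g x l)⁻¹).trace + ∑ r, MvPolynomial.eval (x r) p * l r

open Classical in
/-- The extended real valued function `G`, equal to `+∞` outside `𝓓`. -/
def funG {d J R : ℕ} (n : ℕ) (g : Fin J → MvPolynomial (Fin d) ℝ) (x : Fin R → Fin d → ℝ)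
    (p : MvPolynomial (Fin d) ℝ) (l : EuclideanSpace ℝ (Fin R)) : EReal :=
  if l ∈ domainD n g x then (finiteG n g x p l : EReal) else ⊤

/-- Coercivity: `f(λ) → +∞` as `‖λ‖ → +∞`. -/
def IsCoercive {R : ℕ} (f : EuclideanSpace ℝ (Fin R) → EReal) : Prop :=
  Tendsto f (comap (fun l => ‖l‖) atTop) (𝓝 ⊤)

/-- `λ ∈ 𝓓` is a critical point of `G`: `∇G(λ) = 0`. -/
def IsCriticalG {d J R : ℕ} (n : ℕ) (g : Fin J → MvPolynomial (Fin d) ℝ)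
    (x : Fin R → Fin d → ℝ) (p : MvPolynomial (Fin d) ℝ) (l : EuclideanSpace ℝ (Fin R)) : Prop :=
  l ∈ domainD n g x ∧ HasGradientAt (finiteG n g x p) 0 l

/-- The polynomial `q_ij[λ]`, whose coefficients are the entries in the `j`-th block of the
`i`-th column of `M(λ)⁻¹`. -/
def polyQ {d J R : ℕ} (n : ℕ) (g : Fin J → MvPolynomial (Fin d) ℝ) (x : Fin R → Fin d → ℝ)
    (l : EuclideanSpace ℝ (Fin R)) (i : Idx n g) (j : Fin J) : MvPolynomial (Fin d) ℝ :=
  ∑ α : BlockIdx n (g j), MvPolynomial.monomial α.1 ((matM n g x l)⁻¹ ⟨j, α⟩ i)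

/-- The weighted sum of squares `p[λ] = ∑_j g_j ∑_i q_ij[λ]²`. -/
def sosPoly {d J R : ℕ} (n : ℕ) (g : Fin J → MvPolynomial (Fin d) ℝ) (x : Fin R → Fin d → ℝ)
    (l : EuclideanSpace ℝ (Fin R)) : MvPolynomial (Fin d) ℝ :=
  ∑ j, g j * ∑ i, polyQ n g x l i j ^ 2

/-- The Lukács weights on `[0,1]`: `1, x(1-x)` for even `n` and `x, 1-x` for odd `n`. -/
def lukacsWeights (n : ℕ) : Fin 2 → MvPolynomial (Fin 1) ℝ :=
  if Even n then ![1, MvPolynomial.X 0 * (1 - MvPolynomial.X 0)]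
  else ![MvPolynomial.X 0, 1 - MvPolynomial.X 0]

end SOSInterp

end

/-! For positive definite M, tr M⁻¹ is the maximum over symmetric X of 2 tr X - tr(XMX), attained
only at X = M⁻¹ (`trace_inv_sub_eq`). These bounds are affine in M, so tr M⁻¹ is strictly convex.
Since λ ↦ M(λ) is affine, and injective when the B_r are independent, G is strictly convex whatever
the data (`strictConvexOn_pencilFun`).

Coercivity and existence need data y_r = Φ(B_r) + ε tr B_r with Φ nonnegative on positive
semidefinite matrices. A weighted square g_j q² contributes M ↦ vᵀMv, with v the coefficients of q
(`isGramRep_mul_sq`), and ε p_B contributes the trace. Then G ≥ ε tr M(λ) - const on 𝓓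
(`pencilFun_ge`), and this trace controls ‖λ‖. On a sublevel set tr M⁻¹ is bounded too, which keeps
limits inside 𝓓, so G has a minimizer (`exists_isMin`). It is critical, and the strict tangent
inequality `trace_inv_lt` makes it the only critical point.

On [0,1], factoring through complex roots shows that positive polynomials are Lukács sums of squares
(`mem_lukacsCone_of_pos`). By compactness p - ε p_B stays positive for some ε > 0, so p itself is
admissible data. The equation ∇G = 0 reads tr(M⁻¹B_rM⁻¹) = p(x_r), and the left side is p[λ](x_r).
Two polynomials of degree at most n that agree at n+1 points coincide. -/

noncomputable section

namespace SOSInterp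

/-! ### Trace of the inverse on positive definite matrices -/

section Trace

open Matrix


variable {ι : Type*} [Fintype ι] [DecidableEq ι]

/-- The square completion behind all convexity statements:
`tr (M⁻¹) - 2 tr X + tr (X M X) = tr ((M⁻¹ - X) M (M⁻¹ - X))`. -/
lemma trace_inv_sub_eq {M : Matrix ι ι ℝ} (hM : M.PosDef) (X : Matrix ι ι ℝ) :
    (M⁻¹).trace - (2 * X.trace - (X * M * X).trace) = ((M⁻¹ - X) * M * (M⁻¹ - X)).trace := by
  have hu : IsUnit M.det := (Matrix.isUnit_iff_isUnit_det M).1 hM.isUnit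
  have h : (M⁻¹ - X) * M * (M⁻¹ - X) = M⁻¹ - X - X + X * M * X := by
    have h1 := Matrix.nonsing_inv_mul M hu
    have h2 := Matrix.mul_nonsing_inv M hu
    rw [sub_mul, h1, mul_sub, sub_mul, sub_mul, one_mul, one_mul, Matrix.mul_assoc X M M⁻¹, h2,
      mul_one]
    abel
  rw [h, Matrix.trace_add, Matrix.trace_sub, Matrix.trace_sub]
  ring

omit [DecidableEq ι] in
lemma trace_sandwich_nonneg {M X : Matrix ι ι ℝ} (hM : M.PosSemidef) (hX : X.IsHermitian) :
    0 ≤ (X * M * X).trace := by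
  have h := (hM.conjTranspose_mul_mul_same X).trace_nonneg
  rwa [hX.eq] at h

lemma trace_sandwich_pos {M X : Matrix ι ι ℝ} (hM : M.PosDef) (hX : X.IsHermitian)
    (hX0 : X ≠ 0) : 0 < (X * M * X).trace := by
  refine lt_of_le_of_ne (trace_sandwich_nonneg hM.posSemidef hX) fun h => hX0 ?_
  have hps := hM.posSemidef.conjTranspose_mul_mul_same X
  rw [hX.eq] at hps
  have h0 : X * M * X = 0 := hps.trace_eq_zero_iff.1 h.symm
  ext i j
  by_contra hij
  have hv : X *ᵥ Pi.single j 1 ≠ 0 := fun hv => hij (by simpa using congrFun hv i)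
  have hpos := hM.dotProduct_mulVec_pos hv
  rw [show star (X *ᵥ Pi.single j (1 : ℝ)) = Pi.single j 1 ᵥ* X by
    rw [star_mulVec, hX.eq]; simp, ← dotProduct_mulVec, mulVec_mulVec,
    mulVec_mulVec, h0] at hpos
  simp at hpos

lemma two_trace_sub_le {M X : Matrix ι ι ℝ} (hM : M.PosDef) (hX : X.IsHermitian) :
    2 * X.trace - (X * M * X).trace ≤ (M⁻¹).trace := by
  have h := trace_sandwich_nonneg hM.posSemidef (hM.inv.isHermitian.sub hX)
  rw [← trace_inv_sub_eq hM] at h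
  linarith

lemma two_trace_sub_lt {M X : Matrix ι ι ℝ} (hM : M.PosDef) (hX : X.IsHermitian)
    (hne : M⁻¹ ≠ X) : 2 * X.trace - (X * M * X).trace < (M⁻¹).trace := by
  have h := trace_sandwich_pos hM (hM.inv.isHermitian.sub hX) (sub_ne_zero.2 hne)
  rw [← trace_inv_sub_eq hM] at h
  linarith

lemma posDef_eq_of_inv_eq {M N : Matrix ι ι ℝ} (hM : M.PosDef) (hN : N.PosDef)
    (h : M⁻¹ = N⁻¹) : M = N := by
  have hu : IsUnit M.det := (Matrix.isUnit_iff_isUnit_det M).1 hM.isUnit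
  have hv : IsUnit N.det := (Matrix.isUnit_iff_isUnit_det N).1 hN.isUnit
  rw [← Matrix.nonsing_inv_nonsing_inv M hu, h, Matrix.nonsing_inv_nonsing_inv N hv]

/-- The strict tangent inequality at P: take X = P⁻¹ in the variational bound for N. -/
lemma trace_inv_lt {P N : Matrix ι ι ℝ} (hP : P.PosDef) (hN : N.PosDef) (hne : N ≠ P) :
    (P⁻¹).trace - (P⁻¹ * (N - P) * P⁻¹).trace < (N⁻¹).trace := by
  have h := two_trace_sub_lt hN hP.inv.isHermitian
    (fun h => hne (posDef_eq_of_inv_eq hN hP h))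
  have hu : IsUnit P.det := (Matrix.isUnit_iff_isUnit_det P).1 hP.isUnit
  rw [mul_sub, sub_mul, Matrix.nonsing_inv_mul _ hu, one_mul, Matrix.trace_sub]
  linarith

omit [Fintype ι] [DecidableEq ι] in
lemma convex_posDef : Convex ℝ {M : Matrix ι ι ℝ | M.PosDef} := by
  rw [convex_iff_forall_pos]
  intro M hM N hN a b ha hb _
  exact (Matrix.PosDef.smul hM ha).add (Matrix.PosDef.smul hN hb)

/-- The trace of the inverse is strictly convex on positive definite matrices. -/
lemma strictConvexOn_trace_inv :
    StrictConvexOn ℝ {M : Matrix ι ι ℝ | M.PosDef} fun M => (M⁻¹).trace := by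
  refine ⟨convex_posDef, fun M hM N hN hne a b ha hb hab => ?_⟩
  have hP : (a • M + b • N).PosDef := (Matrix.PosDef.smul hM ha).add (Matrix.PosDef.smul hN hb)
  set P := a • M + b • N with hPd
  have hu : IsUnit P.det := (Matrix.isUnit_iff_isUnit_det P).1 hP.isUnit
  have hMP : M ≠ P := by
    intro h
    have h1 : b • (M - N) = 0 := by
      have h2 : M - P = 0 := sub_eq_zero.2 h
      rw [hPd, show a = 1 - b by linarith] at h2
      rw [← h2]; module
    exact hne (sub_eq_zero.1 ((smul_eq_zero.1 h1).resolve_left hb.ne'))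
  have h1 := mul_lt_mul_of_pos_left (trace_inv_lt hP hM hMP) ha
  -- Strictness already comes from M, so the weak inequality suffices for N.
  have h2 : b * ((P⁻¹).trace - (P⁻¹ * (N - P) * P⁻¹).trace) ≤ b * (N⁻¹).trace := by
    by_cases hNP : N = P
    · simp [hNP]
    · exact (mul_lt_mul_of_pos_left (trace_inv_lt hP hN hNP) hb).le
  have h3 : a * (P⁻¹ * (M - P) * P⁻¹).trace + b * (P⁻¹ * (N - P) * P⁻¹).trace = 0 := by
    have h4 : a • (M - P) + b • (N - P) = 0 := by
      rw [show a • (M - P) + b • (N - P) = (a • M + b • N) - (a + b) • P by module, hab, ← hPd]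
      simp
    have h5 : P⁻¹ * (a • (M - P) + b • (N - P)) * P⁻¹ =
        a • (P⁻¹ * (M - P) * P⁻¹) + b • (P⁻¹ * (N - P) * P⁻¹) := by
      simp only [mul_add, add_mul, Matrix.mul_smul, Matrix.smul_mul]
    have h6 := congrArg Matrix.trace h5
    rw [h4, Matrix.trace_add, Matrix.trace_smul, Matrix.trace_smul] at h6
    simpa using h6.symm
  have h5 : (P⁻¹).trace = a * (P⁻¹).trace + b * (P⁻¹).trace := by rw [← add_mul, hab, one_mul]
  simp only [smul_eq_mul]
  nlinarith

/-- A limit of positive definite matrices whose inverses have bounded trace is positive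
definite; the bound is expressed by inequalities that are linear in the matrix. -/
lemma posDef_of_two_trace_sub_le {M : Matrix ι ι ℝ} (hM : M.PosSemidef) {c : ℝ}
    (hc : ∀ X : Matrix ι ι ℝ, X.IsHermitian → 2 * X.trace - (X * M * X).trace ≤ c) :
    M.PosDef := by
  refine .of_dotProduct_mulVec_pos hM.isHermitian fun v hv => ?_
  refine lt_of_le_of_ne (hM.dotProduct_mulVec_nonneg v) fun h0 => ?_
  have hvv : 0 < v ⬝ᵥ v := by
    have := dotProduct_star_self_pos_iff.2 hv
    simpa using this
  rw [star_trivial] at h0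
  -- For v in the kernel of the quadratic form, X = s vvᵀ makes the bound equal to 2 tr X = 2(|c| +
  -- 1), which exceeds c.
  set s : ℝ := (|c| + 1) / (v ⬝ᵥ v)
  have hX : (s • vecMulVec v v).IsHermitian := by
    ext i j; simp [vecMulVec_apply, mul_comm]
  have h := hc _ hX
  have h1 : (s • vecMulVec v v * M * (s • vecMulVec v v)).trace = 0 := by
    have : vecMulVec v v * M * vecMulVec v v = (v ⬝ᵥ M *ᵥ v) • vecMulVec v v := by
      rw [vecMulVec_mul, vecMulVec_mul_vecMulVec, dotProduct_mulVec, vecMulVec_smul]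
    simp [this, ← h0]
  rw [h1, Matrix.trace_smul, trace_vecMulVec, smul_eq_mul, div_mul_cancel₀ _ hvv.ne'] at h
  have := le_abs_self c
  have := abs_nonneg c
  linarith

/-- Testing the form on e_i ± e_j gives 2|M_ij| ≤ M_ii + M_jj. -/
lemma abs_apply_le_trace {M : Matrix ι ι ℝ} (hM : M.PosSemidef) (i j : ι) :
    |M i j| ≤ M.trace := by
  have hd : ∀ k, M k k ≤ M.trace := fun k =>
    Finset.single_le_sum (f := fun k => M k k) (fun l _ => hM.diag_nonneg) (Finset.mem_univ k)
  have hs : M j i = M i j := by simpa using hM.isHermitian.apply i j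
  have hp := hM.dotProduct_mulVec_nonneg (Pi.single i 1 + Pi.single j 1)
  have hm := hM.dotProduct_mulVec_nonneg (Pi.single i 1 - Pi.single j 1)
  simp [mulVec_add, mulVec_sub, add_dotProduct, sub_dotProduct, hs] at hp hm
  rw [abs_le]
  constructor <;> linarith [hd i, hd j]

omit [DecidableEq ι] in
-- By compactness of the unit sphere, positivity of the form persists near M; homogeneity extends it
-- to all nonzero vectors.
lemma eventually_posDef {M : Matrix ι ι ℝ} (hM : M.PosDef) :
    ∀ᶠ N in 𝓝 M, N.IsHermitian → N.PosDef := by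
  have hK : IsCompact (Metric.sphere (0 : ι → ℝ) 1) := isCompact_sphere _ _
  have hcont : Continuous fun q : Matrix ι ι ℝ × (ι → ℝ) => q.2 ⬝ᵥ q.1 *ᵥ q.2 := by fun_prop
  have h : ∀ᶠ N in 𝓝 M, ∀ v ∈ Metric.sphere (0 : ι → ℝ) 1, 0 < v ⬝ᵥ N *ᵥ v := by
    refine hK.eventually_forall_of_forall_eventually fun v hv => ?_
    refine hcont.continuousAt.eventually (lt_mem_nhds ?_)
    have hv0 : v ≠ 0 := by rintro rfl; simp at hv
    simpa using hM.dotProduct_mulVec_pos hv0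
  filter_upwards [h] with N hN hNh
  refine .of_dotProduct_mulVec_pos hNh fun v hv => ?_
  have hn : 0 < ‖v‖ := norm_pos_iff.2 hv
  have h1 := hN (‖v‖⁻¹ • v) (by simp [norm_smul, hn.ne'])
  rw [mulVec_smul, dotProduct_smul, smul_dotProduct, smul_eq_mul, smul_eq_mul] at h1
  rw [star_trivial]
  have h2 : 0 < ‖v‖⁻¹ := inv_pos.2 hn
  exact pos_of_mul_pos_right (pos_of_mul_pos_right h1 h2.le) h2.le

end Trace

/-! ### Affine matrix pencils and the function G -/

section Pencil

open Matrix


set_option linter.unusedSectionVars false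

variable {ι κ : Type*} [Fintype ι] [DecidableEq ι] [Fintype κ]

/-- The linear part of the matrix pencil. -/
def pencilLin (B : κ → Matrix ι ι ℝ) : EuclideanSpace ℝ κ →ₗ[ℝ] Matrix ι ι ℝ where
  toFun l := ∑ r, l r • B r
  map_add' l m := by simp [add_smul, Finset.sum_add_distrib]
  map_smul' c l := by simp [Finset.smul_sum, smul_smul]

/-- The affine matrix pencil `I + ∑_r λ_r B_r`. -/
def pencil (B : κ → Matrix ι ι ℝ) (l : EuclideanSpace ℝ κ) : Matrix ι ι ℝ :=
  1 + ∑ r, l r • B r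

/-- The function `tr (M(λ)⁻¹) + ∑_r y_r λ_r` of a matrix pencil `M`. -/
def pencilFun (B : κ → Matrix ι ι ℝ) (y : κ → ℝ) (l : EuclideanSpace ℝ κ) : ℝ :=
  (pencil B l)⁻¹.trace + ∑ r, y r * l r

variable {B : κ → Matrix ι ι ℝ} {y : κ → ℝ}

lemma pencil_eq (l : EuclideanSpace ℝ κ) : pencil B l = 1 + pencilLin B l := rfl

lemma pencil_zero : pencil B 0 = 1 := by simp [pencil]

lemma pencil_sub (l m : EuclideanSpace ℝ κ) :
    pencil B l - pencil B m = pencilLin B (l - m) := by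
  rw [pencil_eq, pencil_eq, map_sub]; abel

lemma pencil_combo (l m : EuclideanSpace ℝ κ) {a b : ℝ} (hab : a + b = 1) :
    pencil B (a • l + b • m) = a • pencil B l + b • pencil B m := by
  simp only [pencil_eq, map_add, map_smul, smul_add]
  rw [add_add_add_comm, ← add_smul, hab, one_smul]

lemma pencilLin_injective (hB : LinearIndependent ℝ B) : Function.Injective (pencilLin B) := by
  rw [← LinearMap.ker_eq_bot, LinearMap.ker_eq_bot']
  intro l hl
  ext r
  exact Fintype.linearIndependent_iff.1 hB (fun r => l r) hl r

lemma pencil_injective (hB : LinearIndependent ℝ B) : Function.Injective (pencil B) := by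
  intro l m h
  exact pencilLin_injective hB (add_left_cancel (a := (1 : Matrix ι ι ℝ)) h)

lemma pencil_isHermitian (hB : ∀ r, (B r).IsHermitian) (l : EuclideanSpace ℝ κ) :
    (pencil B l).IsHermitian := by
  unfold Matrix.IsHermitian
  simp only [pencil, conjTranspose_add, conjTranspose_one, conjTranspose_sum,
    conjTranspose_smul, star_trivial, (hB _).eq]

lemma continuous_pencil : Continuous (pencil B) := by
  unfold pencil; fun_prop

lemma sum_linear_eq (f : Matrix ι ι ℝ →ₗ[ℝ] ℝ) (l : EuclideanSpace ℝ κ) :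
    ∑ r, f (B r) * l r = f (pencilLin B l) := by
  simp [pencilLin, mul_comm]

/-- `pencilFun` is strictly convex for linearly independent matrices and arbitrary data. -/
lemma strictConvexOn_pencilFun (hB : LinearIndependent ℝ B) (y : κ → ℝ) :
    StrictConvexOn ℝ {l | (pencil B l).PosDef} (pencilFun B y) := by
  refine ⟨?_, ?_⟩
  · intro l hl m hm a b ha hb hab
    change (pencil B _).PosDef
    rw [pencil_combo l m hab]
    exact convex_posDef hl hm ha hb hab
  · intro l hl m hm hne a b ha hb hab
    have h := strictConvexOn_trace_inv.2 hl hm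
      (fun h => hne (pencil_injective hB h)) ha hb hab
    simp only [pencilFun, pencil_combo l m hab, smul_eq_mul, PiLp.add_apply, PiLp.smul_apply]
      at h ⊢
    have h2 : ∑ r, y r * (a * l r + b * m r) = a * ∑ r, y r * l r + b * ∑ r, y r * m r := by
      rw [Finset.mul_sum, Finset.mul_sum, ← Finset.sum_add_distrib]
      exact Finset.sum_congr rfl fun r _ => by ring
    rw [h2]
    linarith

attribute [local instance] Matrix.linftyOpNormedRing Matrix.linftyOpNormedAlgebra

lemma hasFDerivAt_pencilFun {l : EuclideanSpace ℝ κ} (hl : (pencil B l).PosDef) :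
    ∃ f : EuclideanSpace ℝ κ →L[ℝ] ℝ, HasFDerivAt (pencilFun B y) f l ∧
      ∀ h, f h = -((pencil B l)⁻¹ * pencilLin B h * (pencil B l)⁻¹).trace + ∑ r, y r * h r := by
  obtain ⟨u, hu⟩ := hl.isUnit
  have h1 : HasFDerivAt (pencil B) (LinearMap.toContinuousLinearMap (pencilLin B)) l := by
    have := (LinearMap.toContinuousLinearMap (pencilLin B)).hasFDerivAt (x := l)
    exact this.const_add (1 : Matrix ι ι ℝ)
  -- Inversion has derivative H ↦ -M⁻¹HM⁻¹ at M.
  have h2 := (hasFDerivAt_ringInverse (𝕜 := ℝ) u)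
  rw [hu] at h2
  have h3 := h2.comp l h1
  have h4 := (LinearMap.toContinuousLinearMap (Matrix.traceLinearMap ι ℝ ℝ)).hasFDerivAt.comp l h3
  let g : EuclideanSpace ℝ κ →ₗ[ℝ] ℝ :=
    { toFun := fun h => ∑ r, y r * h r
      map_add' := fun a b => by simp [mul_add, Finset.sum_add_distrib]
      map_smul' := fun c a => by simp [Finset.mul_sum, mul_left_comm] }
  have h5 := h4.add (LinearMap.toContinuousLinearMap g).hasFDerivAt
  have hinv : (↑u⁻¹ : Matrix ι ι ℝ) = (pencil B l)⁻¹ := by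
    rw [← hu, Matrix.coe_units_inv]
  refine ⟨_, h5.congr_of_eventuallyEq (Eventually.of_forall fun m => ?_), fun h => ?_⟩
  · simp [pencilFun, Matrix.nonsing_inv_eq_ringInverse, g]
  · change Matrix.trace (-ContinuousLinearMap.mulLeftRight ℝ (Matrix ι ι ℝ) ↑u⁻¹ ↑u⁻¹
      (pencilLin B h)) + g h = _
    rw [hinv, Matrix.trace_neg]
    rfl

/-- The gradient equations at a critical point. -/
lemma trace_eq_of_critical {l : EuclideanSpace ℝ κ} (hl : (pencil B l).PosDef)
    (hc : HasGradientAt (pencilFun B y) 0 l) (h : EuclideanSpace ℝ κ) :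
    ((pencil B l)⁻¹ * pencilLin B h * (pencil B l)⁻¹).trace = ∑ r, y r * h r := by
  obtain ⟨f, hf, hf'⟩ := hasFDerivAt_pencilFun (y := y) hl
  have h0 := hf.unique (hasGradientAt_iff_hasFDerivAt.1 hc)
  have h1 := hf' h
  rw [h0] at h1
  simp at h1
  linarith

lemma critical_lt {l m : EuclideanSpace ℝ κ} (hB : LinearIndependent ℝ B)
    (hl : (pencil B l).PosDef) (hc : HasGradientAt (pencilFun B y) 0 l)
    (hm : (pencil B m).PosDef) (hne : m ≠ l) : pencilFun B y l < pencilFun B y m := by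
  have h := trace_inv_lt hl hm (fun h => hne (pencil_injective hB h))
  rw [pencil_sub, trace_eq_of_critical hl hc] at h
  simp only [PiLp.sub_apply, mul_sub, Finset.sum_sub_distrib] at h
  unfold pencilFun
  linarith

/-- A global minimizer on the domain is a critical point. -/
lemma critical_of_isMin {l : EuclideanSpace ℝ κ} (hBh : ∀ r, (B r).IsHermitian)
    (hl : (pencil B l).PosDef)
    (hmin : ∀ m, (pencil B m).PosDef → pencilFun B y l ≤ pencilFun B y m) :
    HasGradientAt (pencilFun B y) 0 l := by
  obtain ⟨f, hf, -⟩ := hasFDerivAt_pencilFun (y := y) hl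
  -- Every pencil value is symmetric, so the domain is open in λ and a minimum over it is a local
  -- minimum in the whole space.
  have hloc : IsLocalMin (pencilFun B y) l := by
    filter_upwards [continuous_pencil.continuousAt.eventually (eventually_posDef hl)] with m hm
    exact hmin m (hm (pencil_isHermitian hBh m))
  have := hloc.hasFDerivAt_eq_zero hf
  rw [hasGradientAt_iff_hasFDerivAt, map_zero, ← this]
  exact hf

/-! ### Coercivity and existence of a minimizer -/

section Coercive

variable {Φ : Matrix ι ι ℝ →ₗ[ℝ] ℝ} {ε : ℝ}

/-- The linear term is Φ + ε tr applied to M(λ) - I; the terms tr M(λ)⁻¹ and Φ(M(λ)) are nonnegative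
and are dropped. -/
lemma pencilFun_ge (hΦ : ∀ M : Matrix ι ι ℝ, M.PosSemidef → 0 ≤ Φ M)
    (hy : ∀ r, y r = Φ (B r) + ε * (B r).trace) {l : EuclideanSpace ℝ κ}
    (hl : (pencil B l).PosDef) :
    ε * (pencil B l).trace - (Φ 1 + ε * (1 : Matrix ι ι ℝ).trace) ≤ pencilFun B y l := by
  have h := sum_linear_eq (B := B) (Φ + ε • Matrix.traceLinearMap ι ℝ ℝ) l
  simp only [LinearMap.add_apply, LinearMap.smul_apply, Matrix.traceLinearMap_apply, smul_eq_mul,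
    ← hy] at h
  have h1 := hl.inv.posSemidef.trace_nonneg
  have h2 := hΦ _ hl.posSemidef
  have h3 : Φ (pencil B l) = Φ 1 + Φ (pencilLin B l) := by rw [pencil_eq, map_add]
  have h4 : (pencil B l).trace = (1 : Matrix ι ι ℝ).trace + (pencilLin B l).trace := by
    rw [pencil_eq, Matrix.trace_add]
  rw [pencilFun, h, h4]
  rw [h3] at h2
  linarith

/-- An injective linear map in finite dimension is bounded below, and the entries of a positive
semidefinite matrix are bounded by its trace. -/
lemma exists_norm_le_trace (hB : LinearIndependent ℝ B) :
    ∃ K : ℝ, 0 < K ∧ ∀ l : EuclideanSpace ℝ κ, (pencil B l).PosSemidef →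
      ‖l‖ ≤ K * ((pencil B l).trace + 1) := by
  obtain ⟨K, hK, ha⟩ := (pencilLin B).exists_antilipschitzWith
    (LinearMap.ker_eq_bot.2 (pencilLin_injective hB))
  have hK' : (0 : ℝ) < K := by exact_mod_cast hK
  set N : ℝ := (Fintype.card ι : ℝ) with hN
  have hN0 : 0 ≤ N := by positivity
  refine ⟨K * (N + ‖(1 : Matrix ι ι ℝ)‖ + 1), by positivity, fun l hl => ?_⟩
  have h1 := ha.le_mul_dist l 0
  rw [map_zero, dist_zero_right, dist_zero_right] at h1
  have h2 : ‖pencil B l‖ ≤ N * (pencil B l).trace := by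
    rw [Matrix.linfty_opNorm_def, ← Real.coe_toNNReal _ (mul_nonneg hN0 hl.trace_nonneg)]
    rw [NNReal.coe_le_coe]
    refine Finset.sup_le fun i _ => ?_
    rw [← NNReal.coe_le_coe, Real.coe_toNNReal _ (mul_nonneg hN0 hl.trace_nonneg),
      NNReal.coe_sum]
    calc ∑ j, ((‖pencil B l i j‖₊ : NNReal) : ℝ) ≤ ∑ _j : ι, (pencil B l).trace :=
          Finset.sum_le_sum fun j _ => abs_apply_le_trace hl i j
      _ = N * (pencil B l).trace := by simp [hN]
  have h3 : ‖pencilLin B l‖ ≤ ‖pencil B l‖ + ‖(1 : Matrix ι ι ℝ)‖ := by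
    rw [show pencilLin B l = pencil B l - 1 by rw [pencil_eq]; abel]
    exact norm_sub_le _ _
  have h4 := hl.trace_nonneg
  have h5 := norm_nonneg (1 : Matrix ι ι ℝ)
  calc ‖l‖ ≤ K * ‖pencilLin B l‖ := h1
    _ ≤ K * ((N + ‖(1 : Matrix ι ι ℝ)‖ + 1) * ((pencil B l).trace + 1)) := by
        gcongr; nlinarith [mul_nonneg h5 h4]
    _ = _ := by ring

/-- Quantitative coercivity: sublevel sets are bounded. -/
lemma exists_norm_le_of_pencilFun_le (hB : LinearIndependent ℝ B) (hε : 0 < ε)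
    (hΦ : ∀ M : Matrix ι ι ℝ, M.PosSemidef → 0 ≤ Φ M)
    (hy : ∀ r, y r = Φ (B r) + ε * (B r).trace) (C : ℝ) :
    ∃ ρ : ℝ, ∀ l, (pencil B l).PosDef → pencilFun B y l ≤ C → ‖l‖ ≤ ρ := by
  obtain ⟨K, hK, h⟩ := exists_norm_le_trace hB
  refine ⟨K * ((C + (Φ 1 + ε * (1 : Matrix ι ι ℝ).trace)) / ε + 1), fun l hl hC => ?_⟩
  refine (h l hl.posSemidef).trans ?_
  gcongr
  rw [le_div_iff₀ hε]
  linarith [pencilFun_ge hΦ hy hl]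

lemma exists_isMin (hB : LinearIndependent ℝ B) (hε : 0 < ε)
    (hΦ : ∀ M : Matrix ι ι ℝ, M.PosSemidef → 0 ≤ Φ M)
    (hy : ∀ r, y r = Φ (B r) + ε * (B r).trace) :
    ∃ l, (pencil B l).PosDef ∧
      ∀ m, (pencil B m).PosDef → pencilFun B y l ≤ pencilFun B y m := by
  obtain ⟨ρ, hρ⟩ := exists_norm_le_of_pencilFun_le hB hε hΦ hy (pencilFun B y 0)
  -- Bounds tr M(λ)⁻¹ on the sublevel set of the value at 0, where ‖λ‖ ≤ ρ.
  set c : ℝ := pencilFun B y 0 + ∑ r, |y r| * ρ with hc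
  -- The last condition encodes tr M(λ)⁻¹ ≤ c by inequalities affine in λ. Thus S is visibly closed,
  -- yet it contains only points of the domain.
  let S : Set (EuclideanSpace ℝ κ) := Metric.closedBall 0 ρ ∩
    ({l | (pencil B l).PosSemidef} ∩
      {l | ∀ X : Matrix ι ι ℝ, X.IsHermitian → 2 * X.trace - (X * pencil B l * X).trace ≤ c})
  have hSD : ∀ l ∈ S, (pencil B l).PosDef := fun l hl =>
    posDef_of_two_trace_sub_le hl.2.1 hl.2.2
  have hsub : ∀ l, (pencil B l).PosDef → pencilFun B y l ≤ pencilFun B y 0 → l ∈ S := by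
    intro l hl hle
    have hn := hρ l hl hle
    refine ⟨by simpa using hn, hl.posSemidef, fun X hX => ?_⟩
    refine (two_trace_sub_le hl hX).trans ?_
    have h1 : -∑ r, y r * l r ≤ ∑ r, |y r| * ρ := by
      rw [← Finset.sum_neg_distrib]
      refine Finset.sum_le_sum fun r _ => ?_
      calc -(y r * l r) ≤ |y r * l r| := neg_le_abs _
        _ = |y r| * |l r| := abs_mul _ _
        _ ≤ |y r| * ρ := by
          gcongr
          exact (PiLp.norm_apply_le l r).trans hn
    have h2 : (pencil B l)⁻¹.trace = pencilFun B y l - ∑ r, y r * l r := by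
      simp [pencilFun]
    linarith
  have hclosed : IsClosed S := by
    refine Metric.isClosed_closedBall.inter (IsClosed.inter ?_ ?_)
    · have : {l : EuclideanSpace ℝ κ | (pencil B l).PosSemidef} =
          {l | (pencil B l)ᴴ = pencil B l} ∩
            {l | ∀ v : ι → ℝ, 0 ≤ star v ⬝ᵥ pencil B l *ᵥ v} := by
        ext l
        exact posSemidef_iff_dotProduct_mulVec
      rw [this]
      have hcp : Continuous (pencil B) := continuous_pencil
      refine (isClosed_eq hcp.matrix_conjTranspose hcp).inter ?_
      simp only [Set.ofPred_forall]
      exact isClosed_iInter fun v => isClosed_le continuous_const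
        (Continuous.dotProduct continuous_const (hcp.matrix_mulVec continuous_const))
    · simp only [Set.ofPred_forall]
      have hcp : Continuous (pencil B) := continuous_pencil
      exact isClosed_iInter fun X => isClosed_iInter fun _ => isClosed_le
        (continuous_const.sub
          ((continuous_const.matrix_mul hcp).matrix_mul continuous_const).matrix_trace)
        continuous_const
  have hcomp : IsCompact S := (isCompact_closedBall _ _).of_isClosed_subset hclosed
    Set.inter_subset_left
  have h0 : (0 : EuclideanSpace ℝ κ) ∈ S := hsub 0 (by rw [pencil_zero]; exact .one) le_rfl
  have hcont : ContinuousOn (pencilFun B y) S := fun l hl => by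
    obtain ⟨f, hf, -⟩ := hasFDerivAt_pencilFun (y := y) (hSD l hl)
    exact hf.continuousAt.continuousWithinAt
  obtain ⟨l, hl, hmin⟩ := hcomp.exists_isMinOn ⟨0, h0⟩ hcont
  refine ⟨l, hSD l hl, fun m hm => ?_⟩
  by_cases hle : pencilFun B y m ≤ pencilFun B y 0
  · exact hmin (hsub m hm hle)
  · exact (hmin h0).trans (not_le.1 hle).le

lemma existsUnique_critical (hB : LinearIndependent ℝ B) (hBh : ∀ r, (B r).IsHermitian)
    (hε : 0 < ε) (hΦ : ∀ M : Matrix ι ι ℝ, M.PosSemidef → 0 ≤ Φ M)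
    (hy : ∀ r, y r = Φ (B r) + ε * (B r).trace) :
    ∃! l, (pencil B l).PosDef ∧ HasGradientAt (pencilFun B y) 0 l := by
  obtain ⟨l, hl, hmin⟩ := exists_isMin hB hε hΦ hy
  have hc := critical_of_isMin hBh hl hmin
  refine ⟨l, ⟨hl, hc⟩, fun m hm => ?_⟩
  by_contra hne
  exact lt_asymm (critical_lt hB hl hc hm.1 hne) (critical_lt hB hm.1 hm.2 hl (Ne.symm hne))

end Coercive

end Pencil

/-! ### Gram representations and interpolation by sums of squares -/

section Gram

open Matrix


variable {d J : ℕ} {n : ℕ} {g : Fin J → MvPolynomial (Fin d) ℝ}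

/-- The polynomial with the coefficients in the `j`-th block of a vector. -/
def blockPoly (v : Idx n g → ℝ) (j : Fin J) : MvPolynomial (Fin d) ℝ :=
  ∑ α : BlockIdx n (g j), MvPolynomial.monomial α.1 (v ⟨j, α⟩)

lemma evalB_same (x : Fin d → ℝ) (j : Fin J) (α β : BlockIdx n (g j)) :
    evalB n g x ⟨j, α⟩ ⟨j, β⟩ = MvPolynomial.eval x (g j) *
      (MvPolynomial.eval x (MvPolynomial.monomial α.1 1) *
        MvPolynomial.eval x (MvPolynomial.monomial β.1 1)) := by
  rw [evalB, polyB, Matrix.map_apply, blockDiagonal'_apply_eq]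
  simp only [of_apply, map_mul]

lemma evalB_ne (x : Fin d → ℝ) {j k : Fin J} (h : j ≠ k) (α : BlockIdx n (g j))
    (β : BlockIdx n (g k)) : evalB n g x ⟨j, α⟩ ⟨k, β⟩ = 0 := by
  rw [evalB, polyB, Matrix.map_apply, blockDiagonal'_apply_ne _ _ _ h, map_zero]

lemma evalB_isHermitian (x : Fin d → ℝ) : (evalB n g x).IsHermitian := by
  ext ⟨j, α⟩ ⟨k, β⟩
  rw [conjTranspose_apply, star_trivial]
  by_cases h : j = k
  · subst h
    rw [evalB_same, evalB_same, mul_comm (MvPolynomial.eval x (MvPolynomial.monomial β.1 1))]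
  · rw [evalB_ne x h, evalB_ne x (Ne.symm h)]

lemma eval_blockPoly (x : Fin d → ℝ) (v : Idx n g → ℝ) (j : Fin J) :
    MvPolynomial.eval x (blockPoly v j) =
      ∑ α : BlockIdx n (g j), MvPolynomial.eval x (MvPolynomial.monomial α.1 1) * v ⟨j, α⟩ := by
  rw [blockPoly, map_sum]
  refine Finset.sum_congr rfl fun α _ => ?_
  simp [MvPolynomial.eval_monomial, mul_comm]

lemma evalB_mulVec (x : Fin d → ℝ) (v : Idx n g → ℝ) (j : Fin J) (α : BlockIdx n (g j)) :
    (evalB n g x *ᵥ v) ⟨j, α⟩ = MvPolynomial.eval x (g j) *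
      MvPolynomial.eval x (MvPolynomial.monomial α.1 1) *
        MvPolynomial.eval x (blockPoly v j) := by
  rw [mulVec, dotProduct, Fintype.sum_sigma, Finset.sum_eq_single j]
  · rw [eval_blockPoly, Finset.mul_sum]
    refine Finset.sum_congr rfl fun β _ => ?_
    rw [evalB_same]; ring
  · intro k _ hk
    exact Finset.sum_eq_zero fun β _ => by rw [evalB_ne x (Ne.symm hk), zero_mul]
  · simp

/-- The quadratic form of `B(x)` evaluates weighted squares. -/
lemma dotProduct_evalB_mulVec (x : Fin d → ℝ) (v : Idx n g → ℝ) :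
    v ⬝ᵥ evalB n g x *ᵥ v =
      ∑ j, MvPolynomial.eval x (g j) * MvPolynomial.eval x (blockPoly v j) ^ 2 := by
  rw [dotProduct, Fintype.sum_sigma]
  refine Finset.sum_congr rfl fun j _ => ?_
  rw [sq, ← mul_assoc]
  nth_rw 2 [eval_blockPoly]
  rw [Finset.mul_sum]
  refine Finset.sum_congr rfl fun α _ => ?_
  rw [evalB_mulVec]; ring

/-- `p(x) = Φ(B(x))` for a linear functional `Φ` that is nonnegative on positive semidefinite
matrices. -/
def IsGramRep (n : ℕ) (g : Fin J → MvPolynomial (Fin d) ℝ) (p : MvPolynomial (Fin d) ℝ) : Prop :=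
  ∃ Φ : Matrix (Idx n g) (Idx n g) ℝ →ₗ[ℝ] ℝ,
    (∀ M : Matrix (Idx n g) (Idx n g) ℝ, M.PosSemidef → 0 ≤ Φ M) ∧
      ∀ x, MvPolynomial.eval x p = Φ (evalB n g x)

lemma IsGramRep.zero : IsGramRep n g 0 := ⟨0, by simp, by simp⟩

lemma IsGramRep.add {p q : MvPolynomial (Fin d) ℝ} (hp : IsGramRep n g p)
    (hq : IsGramRep n g q) : IsGramRep n g (p + q) := by
  obtain ⟨Φ, hΦ, h⟩ := hp
  obtain ⟨Ψ, hΨ, h'⟩ := hq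
  exact ⟨Φ + Ψ, fun M hM => add_nonneg (hΦ M hM) (hΨ M hM), fun x => by simp [h, h']⟩

lemma IsGramRep.sum {κ : Type*} (s : Finset κ) {p : κ → MvPolynomial (Fin d) ℝ}
    (hp : ∀ i ∈ s, IsGramRep n g (p i)) : IsGramRep n g (∑ i ∈ s, p i) :=
  Finset.sum_induction p (IsGramRep n g) (fun _ _ => IsGramRep.add) IsGramRep.zero hp

lemma sum_monomial_coeff (w q : MvPolynomial (Fin d) ℝ)
    (hq : ∀ α ∈ q.support, w.totalDegree + 2 * α.degree ≤ n) :
    ∑ α : BlockIdx n w, MvPolynomial.monomial α.1 (q.coeff α.1) = q := by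
  ext β
  rw [MvPolynomial.coeff_sum]
  simp only [MvPolynomial.coeff_monomial]
  by_cases hβ : w.totalDegree + 2 * β.degree ≤ n
  · rw [Finset.sum_eq_single ⟨β, hβ⟩]
    · simp
    · intro α _ hα
      rw [if_neg fun h => hα (Subtype.ext h)]
    · simp
  · have h0 : q.coeff β = 0 := by
      by_contra h
      exact hβ (hq β (MvPolynomial.mem_support_iff.2 h))
    rw [h0]
    refine Finset.sum_eq_zero fun α _ => ?_
    split_ifs with h
    · rw [h, h0]
    · rfl

/-- A single weighted square has a Gram representation. -/
lemma isGramRep_mul_sq (j : Fin J) (q : MvPolynomial (Fin d) ℝ)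
    (hq : ∀ α ∈ q.support, (g j).totalDegree + 2 * α.degree ≤ n) :
    IsGramRep n g (g j * q ^ 2) := by
  let v : Idx n g → ℝ := fun i => if i.1 = j then q.coeff i.2.1 else 0
  have hv : ∀ k, blockPoly v k = if k = j then q else 0 := by
    intro k
    by_cases h : k = j
    · subst h
      simpa [blockPoly, v] using sum_monomial_coeff (g k) q hq
    · simp [blockPoly, v, h]
  let Φ : Matrix (Idx n g) (Idx n g) ℝ →ₗ[ℝ] ℝ :=
    { toFun := fun M => v ⬝ᵥ M *ᵥ v
      map_add' := fun M N => by rw [add_mulVec, dotProduct_add]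
      map_smul' := fun c M => by rw [smul_mulVec, dotProduct_smul]; rfl }
  refine ⟨Φ, fun M hM => hM.dotProduct_mulVec_nonneg v, fun x => ?_⟩
  change _ = v ⬝ᵥ evalB n g x *ᵥ v
  rw [dotProduct_evalB_mulVec, Finset.sum_eq_single j]
  · simp [hv]
  · intro k _ hk; simp [hv, hk]
  · simp

lemma IsWeightedSOS.isGramRep {p : MvPolynomial (Fin d) ℝ} (hp : IsWeightedSOS n g p) :
    IsGramRep n g p := by
  obtain ⟨m, q, hq, rfl⟩ := hp
  simp only [Finset.mul_sum]
  exact IsGramRep.sum _ fun j _ => IsGramRep.sum _ fun i _ => isGramRep_mul_sq j (q i j) (hq i j)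

lemma eval_traceB (x : Fin d → ℝ) :
    MvPolynomial.eval x (traceB n g) = (evalB n g x).trace := by
  simp [traceB, evalB, Matrix.trace]

variable {R : ℕ} {x : Fin R → Fin d → ℝ}

/-- Coercivity and unique critical point for data with a Gram representation. -/
lemma coercive_and_existsUnique (hB : LinearIndependent ℝ (fun r => evalB n g (x r)))
    {p : MvPolynomial (Fin d) ℝ} (hp : IsGramRep n g p) {ε : ℝ} (hε : 0 < ε) :
    IsCoercive (funG n g x (p + ε • traceB n g)) ∧
      ∃! l, IsCriticalG n g x (p + ε • traceB n g) l := by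
  obtain ⟨Φ, hΦ, h⟩ := hp
  have hy : ∀ r, MvPolynomial.eval (x r) (p + ε • traceB n g) =
      Φ (evalB n g (x r)) + ε * (evalB n g (x r)).trace := fun r => by
    rw [map_add, MvPolynomial.smul_eval, eval_traceB, h]
  -- `matM` and `finiteG` are by definition `pencil` and `pencilFun` of the matrices B(x_r), so the
  -- pencil results apply verbatim.
  refine ⟨?_, existsUnique_critical hB (fun r => evalB_isHermitian _) hε hΦ hy⟩
  rw [IsCoercive, EReal.tendsto_nhds_top_iff_real]
  intro C
  obtain ⟨ρ, hρ⟩ := exists_norm_le_of_pencilFun_le hB hε hΦ hy C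
  filter_upwards [tendsto_comap.eventually (eventually_gt_atTop ρ)] with l hl
  unfold funG
  split_ifs with hD
  · rw [EReal.coe_lt_coe_iff]
    by_contra hle
    exact hl.not_ge (hρ l hD (not_lt.1 hle))
  · exact EReal.coe_lt_top C

lemma strictConvexOn_finiteG (hB : LinearIndependent ℝ (fun r => evalB n g (x r)))
    (p : MvPolynomial (Fin d) ℝ) : StrictConvexOn ℝ (domainD n g x) (finiteG n g x p) :=
  strictConvexOn_pencilFun hB _

/-- The i-th diagonal entry is the quadratic form of B(z) on the i-th column of M⁻¹, because M⁻¹ is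
symmetric. -/
lemma eval_sosPoly {l : EuclideanSpace ℝ (Fin R)} (hl : l ∈ domainD n g x) (z : Fin d → ℝ) :
    MvPolynomial.eval z (sosPoly n g x l) =
      ((matM n g x l)⁻¹ * evalB n g z * (matM n g x l)⁻¹).trace := by
  have hW : ((matM n g x l)⁻¹).IsHermitian := (Matrix.PosDef.inv hl).isHermitian
  have h : ∀ i, ((matM n g x l)⁻¹ * evalB n g z * (matM n g x l)⁻¹) i i =
      (fun k => (matM n g x l)⁻¹ k i) ⬝ᵥ evalB n g z *ᵥ (fun k => (matM n g x l)⁻¹ k i) := by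
    intro i
    rw [Matrix.mul_assoc, Matrix.mul_apply, dotProduct]
    refine Finset.sum_congr rfl fun k _ => ?_
    rw [← hW.apply i k, star_trivial]
    rfl
  simp only [Matrix.trace, Matrix.diag, h, dotProduct_evalB_mulVec]
  rw [Finset.sum_comm, sosPoly, map_sum]
  refine Finset.sum_congr rfl fun j _ => ?_
  rw [map_mul, map_sum, Finset.mul_sum]
  refine Finset.sum_congr rfl fun i _ => ?_
  rw [map_pow]
  rfl

/-- At a critical point the weighted sum of squares interpolates `p`. -/
lemma eval_sosPoly_of_critical {p : MvPolynomial (Fin d) ℝ} {l : EuclideanSpace ℝ (Fin R)}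
    (hl : IsCriticalG n g x p l) (r : Fin R) :
    MvPolynomial.eval (x r) (sosPoly n g x l) = MvPolynomial.eval (x r) p := by
  have h := trace_eq_of_critical (B := fun r => evalB n g (x r)) hl.1 hl.2
    (EuclideanSpace.single r 1)
  simp [pencilLin] at h
  rw [eval_sosPoly hl.1, ← h]
  rfl

lemma totalDegree_mul_sq_le (w q : MvPolynomial (Fin d) ℝ) (h : w.totalDegree ≤ n)
    (hq : ∀ α ∈ q.support, w.totalDegree + 2 * α.degree ≤ n) :
    (w * q ^ 2).totalDegree ≤ n := by
  have h1 : 2 * q.totalDegree + w.totalDegree ≤ n := by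
    have : q.totalDegree ≤ (n - w.totalDegree) / 2 := by
      refine Finset.sup_le fun α hα => ?_
      have := hq α hα
      change α.degree ≤ _
      omega
    omega
  have h2 := MvPolynomial.totalDegree_mul w (q ^ 2)
  have h3 := MvPolynomial.totalDegree_pow q 2
  omega

lemma totalDegree_sosPoly_le (l : EuclideanSpace ℝ (Fin R)) :
    (sosPoly n g x l).totalDegree ≤ n := by
  simp only [sosPoly, Finset.mul_sum]
  refine MvPolynomial.totalDegree_finsetSum_le fun j _ =>
    MvPolynomial.totalDegree_finsetSum_le fun i _ => ?_
  by_cases hj : (g j).totalDegree ≤ n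
  · refine totalDegree_mul_sq_le _ _ hj fun α hα => ?_
    by_contra hcon
    refine MvPolynomial.mem_support_iff.1 hα ?_
    rw [polyQ, MvPolynomial.coeff_sum]
    refine Finset.sum_eq_zero fun β _ => ?_
    rw [MvPolynomial.coeff_monomial, if_neg]
    rintro rfl
    exact hcon β.2
  -- If deg g_j > n the block is empty and its polynomials vanish.
  · have : IsEmpty (BlockIdx n (g j)) := ⟨fun α => hj (by have := α.2; omega)⟩
    simp [polyQ]

lemma totalDegree_traceB_le : (traceB n g).totalDegree ≤ n := by
  rw [traceB, Matrix.trace]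
  refine MvPolynomial.totalDegree_finsetSum_le fun i _ => ?_
  obtain ⟨j, α⟩ := i
  rw [Matrix.diag, polyB, blockDiagonal'_apply_eq, of_apply, MvPolynomial.monomial_mul]
  refine (MvPolynomial.totalDegree_mul _ _).trans ?_
  have h1 : (MvPolynomial.monomial (α.1 + α.1) (1 * 1 : ℝ)).totalDegree ≤ (α.1 + α.1).degree :=
    MvPolynomial.totalDegree_monomial_le (α.1 + α.1) (1 * 1 : ℝ)
  rw [map_add] at h1
  have := α.2
  omega

end Gram

/-! ### Lukács' theorem on the unit interval -/

section Lukacs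

open Polynomial

/-- The cone generated by `X^a (1 - X)^b q²` of degree at most `n`, with `a + b ≡ n` modulo `2`. -/
def lukacsCone (n : ℕ) : AddSubmonoid ℝ[X] :=
  AddSubmonoid.closure {p | ∃ (a b : ℕ) (q : ℝ[X]), a + b + 2 * q.natDegree ≤ n ∧
    (a + b) % 2 = n % 2 ∧ p = X ^ a * (1 - X) ^ b * q ^ 2}

lemma generator_mem_lukacsCone {n : ℕ} (a b : ℕ) (q : ℝ[X]) (h : a + b + 2 * q.natDegree ≤ n)
    (hp : (a + b) % 2 = n % 2) : X ^ a * (1 - X) ^ b * q ^ 2 ∈ lukacsCone n :=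
  AddSubmonoid.subset_closure ⟨a, b, q, h, hp, rfl⟩

lemma mul_mem_lukacsCone {m n : ℕ} {p q : ℝ[X]} (hp : p ∈ lukacsCone m)
    (hq : q ∈ lukacsCone n) : p * q ∈ lukacsCone (m + n) := by
  induction hp using AddSubmonoid.closure_induction with
  | zero => simp
  | add p p' _ _ h h' => rw [add_mul]; exact add_mem h h'
  | mem p hp =>
    induction hq using AddSubmonoid.closure_induction with
    | zero => simp
    | add q q' _ _ h h' => rw [mul_add]; exact add_mem h h'
    | mem q hq =>
      obtain ⟨a, b, u, h, hpar, rfl⟩ := hp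
      obtain ⟨a', b', u', h', hpar', rfl⟩ := hq
      have := natDegree_mul_le (p := u) (q := u')
      have h2 := generator_mem_lukacsCone (n := m + n) (a + a') (b + b') (u * u') (by omega)
        (by omega)
      convert h2 using 1
      ring

lemma C_mem_lukacsCone {c : ℝ} (hc : 0 ≤ c) : C c ∈ lukacsCone 0 := by
  have h := generator_mem_lukacsCone (n := 0) 0 0 (C (Real.sqrt c)) (by simp) (by simp)
  rwa [← C_pow, Real.sq_sqrt hc, pow_zero, pow_zero, one_mul, one_mul] at h

lemma linear_mem_lukacsCone {α β : ℝ} (hα : 0 ≤ α) (hβ : 0 ≤ β) :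
    C α * X + C β * (1 - X) ∈ lukacsCone 1 := by
  have hX := generator_mem_lukacsCone (n := 1) 1 0 1 (by simp) (by simp)
  have hX' := generator_mem_lukacsCone (n := 1) 0 1 1 (by simp) (by simp)
  simp only [pow_zero, pow_one, one_mul, mul_one, one_pow] at hX hX'
  have h1 := mul_mem_lukacsCone (C_mem_lukacsCone hα) hX
  have h2 := mul_mem_lukacsCone (C_mem_lukacsCone hβ) hX'
  rw [zero_add] at h1 h2
  exact add_mem h1 h2

/-- The quadratic is (X - Re z)² + (Im z)². -/
lemma quadratic_mem_lukacsCone (z : ℂ) :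
    X ^ 2 - C (2 * z.re) * X + C (‖z‖ ^ 2) ∈ lukacsCone 2 := by
  have h1 := generator_mem_lukacsCone (n := 2) 0 0 (X - C z.re) (by simp) (by simp)
  have h2 := generator_mem_lukacsCone (n := 2) 0 0 (C z.im) (by simp) (by simp)
  convert add_mem h1 h2 using 1
  rw [← Complex.normSq_eq_norm_sq, Complex.normSq_apply]
  simp only [map_add, map_mul, C_ofNat]
  ring

/-- Multiplying by 1 = X + (1 - X) raises the degree bound by one and switches the parity. -/
lemma lukacsCone_mono {m n : ℕ} (h : m ≤ n) : lukacsCone m ≤ lukacsCone n := by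
  induction n, h using Nat.le_induction with
  | base => exact le_rfl
  | succ k _ ih =>
    intro p hp
    have h1 := linear_mem_lukacsCone (α := 1) (β := 1) zero_le_one zero_le_one
    have h2 := mul_mem_lukacsCone (ih hp) h1
    simpa using h2

/-- Lukács' theorem for polynomials that are strictly positive on `[0,1]`. -/
theorem mem_lukacsCone_of_pos : ∀ (n : ℕ) (p : ℝ[X]), p.natDegree ≤ n →
    (∀ t ∈ Set.Icc (0 : ℝ) 1, 0 < p.eval t) → p ∈ lukacsCone n := by
  intro n
  induction n using Nat.strong_induction_on with
  | _ n ih =>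
  intro p hn hp
  by_cases h0 : p.natDegree = 0
  · rw [eq_C_of_natDegree_eq_zero h0]
    refine lukacsCone_mono (Nat.zero_le n) (C_mem_lukacsCone ?_)
    have := hp 0 (by simp)
    rw [eq_C_of_natDegree_eq_zero h0, eval_C] at this
    exact this.le
  have hdeg : (p.map (algebraMap ℝ ℂ)).degree ≠ 0 := by
    rw [degree_map]
    intro h
    exact h0 (natDegree_eq_zero_iff_degree_le_zero.2 h.le)
  obtain ⟨z, hz⟩ := IsAlgClosed.exists_root _ hdeg
  have hz' : aeval z p = 0 := by rwa [IsRoot.def, eval_map_algebraMap] at hz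
  by_cases him : z.im = 0
  · have hzr : z = (z.re : ℂ) := by apply Complex.ext <;> simp [him]
    set a := z.re
    have hroot : p.IsRoot a := by
      rw [hzr] at hz'
      have h1 : aeval (algebraMap ℝ ℂ a) p = algebraMap ℝ ℂ (p.eval a) :=
        aeval_algebraMap_apply_eq_algebraMap_eval a p
      rw [show ((a : ℝ) : ℂ) = algebraMap ℝ ℂ a from rfl, h1] at hz'
      simpa using hz'
    obtain ⟨q, rfl⟩ := dvd_iff_isRoot.2 hroot
    have hq0 : q ≠ 0 := by rintro rfl; simp at h0
    have hqd : q.natDegree + 1 ≤ n := by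
      rw [natDegree_mul (X_sub_C_ne_zero a) hq0, natDegree_X_sub_C] at hn
      omega
    obtain ⟨k, rfl⟩ : ∃ k, n = k + 1 := ⟨n - 1, by omega⟩
    -- Positivity keeps real roots off [0,1], so ±(X - a) is positive there and is a nonnegative
    -- combination of X and 1 - X.
    have ha : a < 0 ∨ 1 < a := by
      by_contra! hcon
      have := hp a hcon
      rw [hroot.eq_zero] at this
      exact lt_irrefl _ this
    rw [add_comm k 1]
    rcases ha with ha | ha
    · have hq := ih k (by omega) q (by omega) fun t ht => by
        have h1 := hp t ht
        rw [eval_mul, eval_sub, eval_X, eval_C] at h1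
        exact pos_of_mul_pos_right h1 (by linarith [ht.1])
      -- X - a = (1 - a)X + (-a)(1 - X).
      have h2 := linear_mem_lukacsCone (α := 1 - a) (β := -a) (by linarith) (by linarith)
      convert mul_mem_lukacsCone h2 hq using 2
      simp only [map_sub, map_neg, map_one]
      ring
    · have hq := ih k (by omega) (-q) (by rw [natDegree_neg]; omega) fun t ht => by
        have h1 := hp t ht
        rw [eval_mul, eval_sub, eval_X, eval_C, ← neg_mul_neg] at h1
        rw [eval_neg]
        exact pos_of_mul_pos_right h1 (by linarith [ht.2])
      -- a - X = (a - 1)X + a(1 - X); the sign is moved to the cofactor.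
      have h2 := linear_mem_lukacsCone (α := a - 1) (β := a) (by linarith) (by linarith)
      convert mul_mem_lukacsCone h2 hq using 1
      simp only [map_sub, map_one]
      ring
  -- A nonreal root and its conjugate split off a real quadratic factor.
  · obtain ⟨q, hq⟩ := p.quadratic_dvd_of_aeval_eq_zero_im_ne_zero hz' him
    have hquad : (X ^ 2 - C (2 * z.re) * X + C (‖z‖ ^ 2) : ℝ[X]).natDegree = 2 := by
      compute_degree!
    have hp0 : p ≠ 0 := by rintro rfl; simp at h0
    have hq0 : q ≠ 0 := by rintro rfl; simp [hp0] at hq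
    have hQ0 : (X ^ 2 - C (2 * z.re) * X + C (‖z‖ ^ 2) : ℝ[X]) ≠ 0 := by
      intro h; rw [h] at hquad; simp at hquad
    have hqd : 2 + q.natDegree ≤ n := by
      rw [hq, natDegree_mul hQ0 hq0, hquad] at hn
      exact hn
    obtain ⟨k, rfl⟩ : ∃ k, n = 2 + k := ⟨n - 2, by omega⟩
    rw [hq]
    refine mul_mem_lukacsCone (quadratic_mem_lukacsCone z) (ih k (by omega) q (by omega) ?_)
    intro t ht
    have h1 := hp t ht
    rw [hq, eval_mul] at h1
    refine pos_of_mul_pos_right h1 ?_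
    simp only [eval_add, eval_sub, eval_mul, eval_pow, eval_X, eval_C]
    rw [← Complex.normSq_eq_norm_sq, Complex.normSq_apply]
    nlinarith [sq_nonneg (t - z.re), sq_nonneg z.im]

end Lukacs

/-! ### The univariate case -/

section Univariate

open MvPolynomial (uniqueAlgEquiv)

lemma eval_uniqueAlgEquiv (p : MvPolynomial (Fin 1) ℝ) (t : ℝ) :
    (uniqueAlgEquiv ℝ (Fin 1) p).eval t = MvPolynomial.eval (fun _ => t) p := by
  induction p using MvPolynomial.induction_on with
  | C a => simp
  | add p q hp hq => simp only [map_add, Polynomial.eval_add, hp, hq]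
  | mul_X p i hp => simp only [map_mul, Polynomial.eval_mul, hp]; simp

lemma natDegree_uniqueAlgEquiv_le (p : MvPolynomial (Fin 1) ℝ) :
    (uniqueAlgEquiv ℝ (Fin 1) p).natDegree ≤ p.totalDegree := by
  rw [Polynomial.natDegree_le_iff_coeff_eq_zero]
  intro k hk
  rw [MvPolynomial.coeff_uniqueAlgEquiv]
  refine MvPolynomial.coeff_eq_zero_of_totalDegree_lt ?_
  rwa [← Finsupp.degree_apply, Finsupp.degree_single]

lemma degree_le_of_mem_support_uniqueAlgEquiv_symm (q : Polynomial ℝ) {α : Fin 1 →₀ ℕ}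
    (hα : α ∈ ((uniqueAlgEquiv ℝ (Fin 1)).symm q).support) : α.degree ≤ q.natDegree := by
  rw [MvPolynomial.mem_support_iff, MvPolynomial.coeff_uniqueAlgEquiv_symm] at hα
  rw [Finsupp.degree_eq_sum]
  simpa using Polynomial.le_natDegree_of_ne_zero hα

/-- Polynomials in one variable of degree at most `n` are determined by `n + 1` values. -/
lemma eq_of_eval_eq {n : ℕ} {t : Fin (n + 1) → ℝ} (ht : Function.Injective t)
    {p q : MvPolynomial (Fin 1) ℝ} (hp : p.totalDegree ≤ n) (hq : q.totalDegree ≤ n)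
    (h : ∀ r, MvPolynomial.eval (fun _ => t r) p = MvPolynomial.eval (fun _ => t r) q) :
    p = q := by
  apply (uniqueAlgEquiv ℝ (Fin 1)).injective
  have hdeg : ∀ p : MvPolynomial (Fin 1) ℝ, p.totalDegree ≤ n →
      (uniqueAlgEquiv ℝ (Fin 1) p).degree < (Finset.univ : Finset (Fin (n + 1))).card := by
    intro p hp
    refine Polynomial.degree_le_natDegree.trans_lt ?_
    rw [Finset.card_univ, Fintype.card_fin]
    exact_mod_cast Nat.lt_succ_of_le ((natDegree_uniqueAlgEquiv_le p).trans hp)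
  refine Polynomial.eq_of_degrees_lt_of_eval_index_eq Finset.univ ht.injOn (hdeg p hp) (hdeg q hq)
    fun r _ => ?_
  rw [eval_uniqueAlgEquiv, eval_uniqueAlgEquiv, h]

lemma totalDegree_X_zero_le : (MvPolynomial.X 0 : MvPolynomial (Fin 1) ℝ).totalDegree ≤ 1 := by
  rw [MvPolynomial.totalDegree_X]

lemma totalDegree_one_sub_X_le :
    (1 - MvPolynomial.X 0 : MvPolynomial (Fin 1) ℝ).totalDegree ≤ 1 := by
  refine (MvPolynomial.totalDegree_sub _ _).trans ?_
  simp

lemma totalDegree_X_mul_one_sub_X_le :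
    (MvPolynomial.X 0 * (1 - MvPolynomial.X 0) : MvPolynomial (Fin 1) ℝ).totalDegree ≤ 2 := by
  refine (MvPolynomial.totalDegree_mul _ _).trans ?_
  have := totalDegree_one_sub_X_le
  have := totalDegree_X_zero_le
  omega

lemma lukacsWeights_even {n : ℕ} (hn : Even n) :
    lukacsWeights n = ![1, MvPolynomial.X 0 * (1 - MvPolynomial.X 0)] := if_pos hn

lemma lukacsWeights_odd {n : ℕ} (hn : ¬ Even n) :
    lukacsWeights n = ![MvPolynomial.X 0, 1 - MvPolynomial.X 0] := if_neg hn

lemma exists_lukacsWeights_eq {n a b : ℕ} (h : (a + b) % 2 = n % 2) :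
    ∃ j, lukacsWeights n j =
        MvPolynomial.X 0 ^ (a % 2) * (1 - MvPolynomial.X 0) ^ (b % 2) ∧
      (lukacsWeights n j).totalDegree ≤ a % 2 + b % 2 := by
  by_cases hn : Even n
  · rw [lukacsWeights_even hn]
    rw [Nat.even_iff] at hn
    rcases Nat.mod_two_eq_zero_or_one a with ha | ha
    · have hb : b % 2 = 0 := by omega
      exact ⟨0, by simp [ha, hb], by simp⟩
    · have hb : b % 2 = 1 := by omega
      refine ⟨1, by simp [ha, hb], ?_⟩
      rw [ha, hb]
      exact totalDegree_X_mul_one_sub_X_le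
  · rw [lukacsWeights_odd hn]
    rw [Nat.even_iff] at hn
    rcases Nat.mod_two_eq_zero_or_one a with ha | ha
    · have hb : b % 2 = 1 := by omega
      refine ⟨1, by simp [ha, hb], ?_⟩
      rw [ha, hb]
      exact totalDegree_one_sub_X_le
    · have hb : b % 2 = 0 := by omega
      refine ⟨0, by simp [ha, hb], ?_⟩
      rw [ha, hb]
      exact totalDegree_X_zero_le

lemma isGramRep_of_mem_lukacsCone {n : ℕ} {p : Polynomial ℝ} (hp : p ∈ lukacsCone n) :
    IsGramRep n (lukacsWeights n) ((uniqueAlgEquiv ℝ (Fin 1)).symm p) := by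
  induction hp using AddSubmonoid.closure_induction with
  | zero => rw [map_zero]; exact IsGramRep.zero
  | add p q _ _ hp hq => rw [map_add]; exact hp.add hq
  | mem p hp =>
    obtain ⟨a, b, q, h, hpar, rfl⟩ := hp
    obtain ⟨j, hj, hdeg⟩ := exists_lukacsWeights_eq hpar
    -- Even parts of the exponents go into the square; the remaining X^(a % 2) (1 - X)^(b % 2) is a
    -- Lukács weight.
    set s : Polynomial ℝ := Polynomial.X ^ (a / 2) * (1 - Polynomial.X) ^ (b / 2) * q with hs
    have hX : (uniqueAlgEquiv ℝ (Fin 1)).symm Polynomial.X = MvPolynomial.X 0 := by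
      simp [uniqueAlgEquiv]
    have hsd : s.natDegree ≤ a / 2 + b / 2 + q.natDegree := by
      refine Polynomial.natDegree_mul_le_of_le (Polynomial.natDegree_mul_le_of_le ?_ ?_) le_rfl
      · simp
      · have h1 : (1 - Polynomial.X : Polynomial ℝ).natDegree ≤ 1 := by compute_degree
        exact (Polynomial.natDegree_pow_le_of_le _ h1).trans (by simp)
    have heq : (uniqueAlgEquiv ℝ (Fin 1)).symm
        (Polynomial.X ^ a * (1 - Polynomial.X) ^ b * q ^ 2) =
        lukacsWeights n j * ((uniqueAlgEquiv ℝ (Fin 1)).symm s) ^ 2 := by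
      rw [hj, hs]
      simp only [map_mul, map_pow, map_sub, map_one, hX]
      nth_rw 1 [← Nat.mod_add_div a 2, ← Nat.mod_add_div b 2]
      ring
    rw [heq]
    refine isGramRep_mul_sq j _ fun α hα => ?_
    have := degree_le_of_mem_support_uniqueAlgEquiv_symm s hα
    omega

/-- The entries of the blocks yield every moment ∑ c_r t_r^k with k ≤ n, and the Vandermonde matrix
of distinct points is invertible. -/
lemma linearIndependent_evalB_lukacs {n : ℕ} {t : Fin (n + 1) → ℝ}
    (ht : Function.Injective t) :
    LinearIndependent ℝ (fun r => evalB n (lukacsWeights n) (fun _ => t r)) := by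
  rw [Fintype.linearIndependent_iff]
  intro c hc
  have hentry : ∀ (j : Fin 2) (a b : ℕ), (lukacsWeights n j).totalDegree + 2 * a ≤ n →
      (lukacsWeights n j).totalDegree + 2 * b ≤ n →
      ∑ r, c r * (MvPolynomial.eval (fun _ => t r) (lukacsWeights n j) * t r ^ (a + b)) = 0 := by
    intro j a b ha hb
    have h := congrFun (congrFun hc ⟨j, ⟨Finsupp.single 0 a, by simpa using ha⟩⟩)
      ⟨j, ⟨Finsupp.single 0 b, by simpa using hb⟩⟩
    rw [Matrix.sum_apply] at h
    simp only [Matrix.smul_apply, evalB_same, smul_eq_mul, Matrix.zero_apply] at h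
    rw [← h]
    refine Finset.sum_congr rfl fun r _ => ?_
    simp [MvPolynomial.eval_monomial, pow_add]
  have hpow : ∀ k ≤ n, ∑ r, c r * t r ^ k = 0 := by
    intro k hk
    by_cases hn : Even n
    · have h0 : lukacsWeights n 0 = 1 := by rw [lukacsWeights_even hn]; rfl
      rw [Nat.even_iff] at hn
      -- As n is even, k ≤ n forces ⌈k/2⌉ ≤ n/2, so both indices lie in the block.
      have h := hentry 0 (k / 2) (k - k / 2) (by rw [h0, MvPolynomial.totalDegree_one]; omega)
        (by rw [h0, MvPolynomial.totalDegree_one]; omega)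
      rw [h0, Nat.add_sub_cancel' (by omega)] at h
      simpa using h
    · have h0 : lukacsWeights n 0 = MvPolynomial.X 0 := by rw [lukacsWeights_odd hn]; rfl
      have h1 : lukacsWeights n 1 = 1 - MvPolynomial.X 0 := by rw [lukacsWeights_odd hn]; rfl
      have hd0 := totalDegree_X_zero_le
      have hd1 := totalDegree_one_sub_X_le
      rw [Nat.even_iff] at hn
      have hsucc : ∀ m < n, ∑ r, c r * t r ^ (m + 1) = 0 := by
        intro m hm
        have h := hentry 0 (m / 2) (m - m / 2) (by rw [h0]; omega) (by rw [h0]; omega)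
        rw [h0, Nat.add_sub_cancel' (by omega)] at h
        simpa [pow_succ'] using h
      rcases Nat.eq_zero_or_pos k with rfl | hk0
      -- The weight x gives only the powers 1 to n; the weight 1 - x recovers the constant one.
      · have h := hentry 1 0 0 (by rw [h1]; omega) (by rw [h1]; omega)
        have h' := hsucc 0 (by omega)
        rw [h1] at h
        simp [mul_sub, Finset.sum_sub_distrib] at h h'
        rw [h', sub_zero] at h
        simpa using h
      · obtain ⟨m, rfl⟩ : ∃ m, k = m + 1 := ⟨k - 1, by omega⟩
        exact hsucc m (by omega)
  have := Matrix.eq_zero_of_forall_pow_sum_mul_pow_eq_zero ht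
    (v := c) fun i => hpow i (by omega)
  exact fun r => congrFun this r

lemma exists_pos_sub_smul {p q : Polynomial ℝ}
    (hp : ∀ z ∈ Set.Icc (0 : ℝ) 1, 0 < p.eval z) :
    ∃ ε : ℝ, 0 < ε ∧ ∀ z ∈ Set.Icc (0 : ℝ) 1, 0 < (p - ε • q).eval z := by
  have hne : (Set.Icc (0 : ℝ) 1).Nonempty := ⟨0, by simp⟩
  obtain ⟨z₀, hz₀, hmin⟩ := isCompact_Icc.exists_isMinOn hne p.continuous.continuousOn
  obtain ⟨z₁, -, hmax⟩ := isCompact_Icc.exists_isMaxOn hne q.continuous.continuousOn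
  have hm := hp z₀ hz₀
  have hM : 0 < |q.eval z₁| + 1 := by positivity
  -- Minimum of p over a strict upper bound for q; the added 1 keeps the denominator positive.
  refine ⟨p.eval z₀ / (|q.eval z₁| + 1), div_pos hm hM, fun z hz => ?_⟩
  have h1 : p.eval z₀ ≤ p.eval z := hmin hz
  have h2 : q.eval z < |q.eval z₁| + 1 :=
    (hmax hz : q.eval z ≤ q.eval z₁).trans_lt ((le_abs_self _).trans_lt (lt_add_one _))
  have h3 := mul_lt_mul_of_pos_left h2 (div_pos hm hM)
  rw [div_mul_cancel₀ _ hM.ne'] at h3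
  rw [Polynomial.eval_sub, Polynomial.eval_smul, smul_eq_mul]
  linarith

/-- A polynomial that is positive on `[0,1]` is a multiple `ε p_B` plus a polynomial with a Gram
representation. -/
lemma exists_isGramRep_add {n : ℕ} {p : MvPolynomial (Fin 1) ℝ} (hd : p.totalDegree ≤ n)
    (hp : ∀ z ∈ Set.Icc (0 : ℝ) 1, 0 < MvPolynomial.eval (fun _ => z) p) :
    ∃ ε : ℝ, 0 < ε ∧ ∃ q, IsGramRep n (lukacsWeights n) q ∧
      p = q + ε • traceB n (lukacsWeights n) := by
  obtain ⟨ε, hε, h⟩ := exists_pos_sub_smul (p := uniqueAlgEquiv ℝ (Fin 1) p)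
    (q := uniqueAlgEquiv ℝ (Fin 1) (traceB n (lukacsWeights n)))
    fun z hz => by rw [eval_uniqueAlgEquiv]; exact hp z hz
  refine ⟨ε, hε, p - ε • traceB n (lukacsWeights n), ?_, by abel⟩
  rw [← map_smul, ← map_sub] at h
  have hdeg : (p - ε • traceB n (lukacsWeights n)).totalDegree ≤ n :=
    (MvPolynomial.totalDegree_sub _ _).trans
      (max_le hd ((MvPolynomial.totalDegree_smul_le _ _).trans totalDegree_traceB_le))
  have h2 := isGramRep_of_mem_lukacsCone
    (mem_lukacsCone_of_pos n _ ((natDegree_uniqueAlgEquiv_le _).trans hdeg) h)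
  rwa [AlgEquiv.symm_apply_apply] at h2

end Univariate

end SOSInterp

end

theorem theorem2 :
    -- multivariate case
    (∀ (d J n R : ℕ) (g : Fin J → MvPolynomial (Fin d) ℝ) (x : Fin R → Fin d → ℝ),
      SOSInterp.IsUnisolvent n x →
      (∀ r, x r ∈ SOSInterp.semialgSet g) →
      LinearIndependent ℝ (fun r => SOSInterp.evalB n g (x r)) →
      (∀ p : MvPolynomial (Fin d) ℝ, SOSInterp.IsWeightedSOS n g p → ∀ ε : ℝ, 0 < ε →
        SOSInterp.IsCoercive (SOSInterp.funG n g x (p + ε • SOSInterp.traceB n g)) ∧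
        StrictConvexOn ℝ (SOSInterp.domainD n g x)
          (SOSInterp.finiteG n g x (p + ε • SOSInterp.traceB n g)) ∧
        ∃! l, SOSInterp.IsCriticalG n g x (p + ε • SOSInterp.traceB n g) l) ∧
      (∀ p ∈ MvPolynomial.restrictTotalDegree (Fin d) ℝ n,
        (∀ z ∈ SOSInterp.semialgSet g, 0 < MvPolynomial.eval z p) →
        StrictConvexOn ℝ (SOSInterp.domainD n g x) (SOSInterp.finiteG n g x p))) ∧
    -- univariate case on the segment, with the points `t_1, …, t_{n+1}`
    (∀ (n : ℕ) (t : Fin (n + 1) → ℝ), Function.Injective t → (∀ r, t r ∈ Set.Icc (0 : ℝ) 1) →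
      LinearIndependent ℝ
        (fun r => SOSInterp.evalB n (SOSInterp.lukacsWeights n) (fun _ => t r)) ∧
      ∀ p ∈ MvPolynomial.restrictTotalDegree (Fin 1) ℝ n,
        (∀ z ∈ Set.Icc (0 : ℝ) 1, 0 < MvPolynomial.eval (fun _ => z) p) →
        StrictConvexOn ℝ (SOSInterp.domainD n (SOSInterp.lukacsWeights n) (fun r _ => t r))
          (SOSInterp.finiteG n (SOSInterp.lukacsWeights n) (fun r _ => t r) p) ∧
        SOSInterp.IsCoercive
          (SOSInterp.funG n (SOSInterp.lukacsWeights n) (fun r _ => t r) p) ∧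
        (∃! l, SOSInterp.IsCriticalG n (SOSInterp.lukacsWeights n) (fun r _ => t r) p l) ∧
        ∀ l, SOSInterp.IsCriticalG n (SOSInterp.lukacsWeights n) (fun r _ => t r) p l →
          SOSInterp.sosPoly n (SOSInterp.lukacsWeights n) (fun r _ => t r) l = p) := by
  refine ⟨fun d J n R g x _ _ hB => ⟨fun p hp ε hε => ?_, fun p _ _ =>
    SOSInterp.strictConvexOn_finiteG hB p⟩, fun n t ht _ =>
    ⟨SOSInterp.linearIndependent_evalB_lukacs ht, fun p hp hpos => ?_⟩⟩
  · obtain ⟨hc, hu⟩ := SOSInterp.coercive_and_existsUnique hB hp.isGramRep hε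
    exact ⟨hc, SOSInterp.strictConvexOn_finiteG hB _, hu⟩
  · have hB := SOSInterp.linearIndependent_evalB_lukacs ht
    rw [MvPolynomial.mem_restrictTotalDegree] at hp
    refine ⟨SOSInterp.strictConvexOn_finiteG hB p, ?_⟩
    obtain ⟨ε, hε, q, hq, hpq⟩ := SOSInterp.exists_isGramRep_add hp hpos
    obtain ⟨hc, hu⟩ := SOSInterp.coercive_and_existsUnique hB hq hε
    rw [← hpq] at hc hu
    exact ⟨hc, hu, fun l hl => SOSInterp.eq_of_eval_eq ht
      (SOSInterp.totalDegree_sosPoly_le l) hp (SOSInterp.eval_sosPoly_of_critical hl)⟩
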